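/- A Stackelberg planning task is a tuple $(V, A^L, A^F, I, G)$ of a finite set $V$ of propositional facts, finitely many leader actions $A^L$ and follower actions $A^F$, an initial state $I \subseteq V$ and a goal $G \subseteq V$ of the follower. A state is a set $s \subseteq V$ of facts. Each action $a$ has a precondition $\mathrm{pre}(a)$ (a conjunction of literals over $V$), an add effect $\mathrm{add}(a) \subseteq V$, a delete effect $\mathrm{del}(a) \subseteq V$ and a cost in $\mathbb{N}_0$; it is applicable in $s$ iff $s \models \mathrm{pre}(a)$, and executing it yields $(s \setminus \mathrm{del}(a)) \cup \mathrm{add}(a)$. A leader plan is a (possibly empty) finite sequence of leader actions that is applicable in $I$. If it leads to the state $s$, then the induced follower task is solvable iff some (possibly empty) finite sequence of follower actions is applicable in $s$ and leads to a state containing $G$. STACKELSAT asks, given a Stackelberg planning task, whether there is a leader plan whose induced follower task is unsolvable. Theorem. STACKELSAT$^0$, the restriction of STACKELSAT to tasks in which no leader or follower action has a precondition (while the number of add and delete effects per action is arbitrary), is decidable in polynomial time: there is a deterministic Turing machine that decides it in a number of steps bounded by a polynomial in the length of the encoding of the given task, where a task is encoded by listing for each fact whether it belongs to $I$ and to $G$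 and, for each action, its owner, for each fact its membership in the positive and negative preconditions, the add effect and the delete effect, and the cost in binary. -/

import Mathlib

namespace Stackelberg

/-! ### STRIPS planning -/

/-- An action over the facts `V`: a precondition, which is a conjunction of the positive literals
`prePos` and of the negations of `preNeg`, an add effect, a delete effect and a cost. -/
structure Action (V : Type) where
  prePos : Finset V
  preNeg : Finset V
  add : Finset V
  del : Finset V
  cost : ℕ

/-- A classical planning task over the facts `V`. -/
structure PlanningTask (V : Type) where
  actions : List (Action V)
  init : Finset V
  goal : Finset V

/-- A Stackelberg planning task over the facts `V`. -/
structure StackelbergTask (V : Type) where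
  leaderActions : List (Action V)
  followerActions : List (Action V)
  init : Finset V
  goal : Finset V

section Semantics

variable {V : Type} [DecidableEq V]

/-- The number of literals in the precondition. -/
def Action.preCard (a : Action V) : ℕ := a.prePos.card + a.preNeg.card

/-- The number of effects. -/
def Action.effCard (a : Action V) : ℕ := a.add.card + a.del.card

/-- The action is applicable in the state `s` (the set of facts that hold). -/
def Action.Applicable (a : Action V) (s : Finset V) : Prop :=
  a.prePos ⊆ s ∧ Disjoint a.preNeg s

/-- The state that results from executing the action in `s`. -/
def Action.apply (a : Action V) (s : Finset V) : Finset V := (s \ a.del) ∪ a.add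

/-- An action sequence is applicable in `s`. -/
def SeqApplicable : List (Action V) → Finset V → Prop
  | [], _ => True
  | a :: π, s => a.Applicable s ∧ SeqApplicable π (a.apply s)

/-- The state that results from executing an action sequence in `s`. -/
def seqApply : List (Action V) → Finset V → Finset V
  | [], s => s
  | a :: π, s => seqApply π (a.apply s)

/-- `π` is a plan for the classical planning task `P`. -/
def PlanningTask.IsPlan (P : PlanningTask V) (π : List (Action V)) : Prop :=
  (∀ a ∈ π, a ∈ P.actions) ∧ SeqApplicable π P.init ∧ P.goal ⊆ seqApply π P.init

def PlanningTask.Unsolvable (P : PlanningTask V) : Prop := ¬ ∃ π, P.IsPlan π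

/-- A leader plan: a sequence of leader actions applicable in the initial state. -/
def StackelbergTask.IsLeaderPlan (T : StackelbergTask V) (π : List (Action V)) : Prop :=
  (∀ a ∈ π, a ∈ T.leaderActions) ∧ SeqApplicable π T.init

/-- The follower task induced by a leader plan. -/
def StackelbergTask.followerTask (T : StackelbergTask V) (π : List (Action V)) :
    PlanningTask V where
  actions := T.followerActions
  init := seqApply π T.init
  goal := T.goal

/-- Some leader plan makes the induced follower task unsolvable. -/
def StackelbergTask.Sat (T : StackelbergTask V) : Prop :=
  ∃ π, T.IsLeaderPlan π ∧ (T.followerTask π).Unsolvable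

end Semantics

/-! ### The decision problems -/

/-- An instance: a Stackelberg task whose finitely many facts are numbered `0, 1, …`. -/
structure Instance where
  numFacts : ℕ
  task : StackelbergTask (Fin numFacts)

/-- `STACKELSAT`, as the set of its yes-instances. -/
def STACKELSAT : Set Instance := {T | T.task.Sat}

/-- The restriction of `STACKELSAT` to tasks in which every action has at most `m` preconditions
and at most `n` effects, as the set of its yes-instances; `⊤` stands for no bound. -/
def STACKELSATRestricted (m n : ℕ∞) : Set Instance :=
  {T | (∀ a ∈ T.task.leaderActions ++ T.task.followerActions,
      (a.preCard : ℕ∞) ≤ m ∧ (a.effCard : ℕ∞) ≤ n) ∧ T ∈ STACKELSAT}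

/-! ### Encoding of instances as words, and polynomial time -/

/-- The finite alphabet in which instances are written. -/
inductive Sym : Type
  /-- the entry of one fact in the description of the initial state and the goal -/
  | state (inInit inGoal : Bool)
  /-- marks the beginning of a leader action -/
  | leader
  /-- marks the beginning of a follower action -/
  | follower
  /-- the entry of one fact in the description of an action -/
  | fact (inPrePos inPreNeg inAdd inDel : Bool)
  /-- one bit of the cost of an action -/
  | costBit (b : Bool)
  deriving DecidableEq, Fintype

/-- An action is written as one symbol per fact, followed by its cost in binary. -/
def Action.encode {n : ℕ} (a : Action (Fin n)) : List Sym :=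
  List.ofFn (fun v => Sym.fact (decide (v ∈ a.prePos)) (decide (v ∈ a.preNeg))
    (decide (v ∈ a.add)) (decide (v ∈ a.del))) ++
  (Computability.encodeNat a.cost).map Sym.costBit

/-- An instance is written as one symbol per fact for the initial state and the goal, followed by
the leader actions and the follower actions, each one preceded by a marker. -/
def Instance.encode (T : Instance) : List Sym :=
  List.ofFn (fun v => Sym.state (decide (v ∈ T.task.init)) (decide (v ∈ T.task.goal))) ++
  T.task.leaderActions.flatMap (fun a => Sym.leader :: a.encode) ++
  T.task.followerActions.flatMap (fun a => Sym.follower :: a.encode)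

theorem append_inj_of_separated {α : Type} (p : α → Prop) [DecidablePred p]
    {l₁ r₁ l₂ r₂ : List α}
    (h₁ : ∀ x ∈ l₁, p x) (h₂ : ∀ x ∈ l₂, p x) (k₁ : ∀ x ∈ r₁.head?, ¬ p x)
    (k₂ : ∀ x ∈ r₂.head?, ¬ p x) (h : l₁ ++ r₁ = l₂ ++ r₂) : l₁ = l₂ ∧ r₁ = r₂ := by
  have key : ∀ l r : List α, (∀ x ∈ l, p x) → (∀ x ∈ r.head?, ¬ p x) →
      (l ++ r).takeWhile (fun x => decide (p x)) = l := by
    intro l r hl hr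
    rw [List.takeWhile_append_of_pos (by simpa using hl)]
    cases r with
    | nil => simp
    | cons x r => simp at hr; simp [hr]
  have e : l₁ = l₂ := by
    rw [← key l₁ r₁ h₁ k₁, h, key l₂ r₂ h₂ k₂]
  subst e
  exact ⟨rfl, List.append_cancel_left h⟩

theorem Action.encode_injective {n : ℕ} : Function.Injective (Action.encode (n := n)) := by
  intro a b h
  obtain ⟨h₁, h₂⟩ := List.append_inj h (by simp)
  have h₃ := List.ofFn_injective h₁
  have h₄ : a.cost = b.cost := by
    have := List.map_injective_iff.2 (fun x y e => Sym.costBit.inj e) h₂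
    rw [← Computability.decode_encodeNat a.cost, this, Computability.decode_encodeNat]
  cases a; cases b
  simp only [Action.mk.injEq]
  simp only [funext_iff, Sym.fact.injEq, decide_eq_decide] at h₃
  refine ⟨Finset.ext fun v => (h₃ v).1, Finset.ext fun v => (h₃ v).2.1,
    Finset.ext fun v => (h₃ v).2.2.1, Finset.ext fun v => (h₃ v).2.2.2, h₄⟩

theorem flatMap_encode_injective {n : ℕ} (m : Sym)
    (hm : m = Sym.leader ∨ m = Sym.follower) {l₁ l₂ : List (Action (Fin n))} {r₁ r₂ : List Sym}
    (k₁ : ∀ x ∈ r₁.head?, x ≠ m ∧ (x = Sym.leader ∨ x = Sym.follower))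
    (k₂ : ∀ x ∈ r₂.head?, x ≠ m ∧ (x = Sym.leader ∨ x = Sym.follower))
    (h : l₁.flatMap (fun a => m :: a.encode) ++ r₁ = l₂.flatMap (fun a => m :: a.encode) ++ r₂) :
    l₁ = l₂ ∧ r₁ = r₂ := by
  have hh : ∀ (l : List (Action (Fin n))) (r : List Sym),
      (∀ x ∈ r.head?, x ≠ m ∧ (x = Sym.leader ∨ x = Sym.follower)) →
      ∀ x ∈ (l.flatMap (fun a => m :: a.encode) ++ r).head?,
        ¬ (x ≠ Sym.leader ∧ x ≠ Sym.follower) := by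
    intro l r hr x hx
    cases l with
    | nil => have := hr x (by simpa using hx); tauto
    | cons a l => simp at hx; subst hx; tauto
  have hb : ∀ a : Action (Fin n), ∀ x ∈ a.encode, x ≠ Sym.leader ∧ x ≠ Sym.follower := by
    intro a x hx
    simp only [Action.encode, List.mem_append, List.mem_ofFn, List.mem_map] at hx
    rcases hx with ⟨v, rfl⟩ | ⟨v, _, rfl⟩ <;> simp
  induction l₁ generalizing l₂ with
  | nil =>
    cases l₂ with
    | nil => exact ⟨rfl, by simpa using h⟩
    | cons b l₂ => simp at h; subst h; simp at k₁
  | cons a l₁ ih =>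
    cases l₂ with
    | nil => simp at h; subst h; simp at k₂
    | cons b l₂ =>
      simp only [List.flatMap_cons, List.cons_append, List.append_assoc, List.cons.injEq,
        true_and] at h
      obtain ⟨h₁, h₂⟩ := append_inj_of_separated
        (fun x => x ≠ Sym.leader ∧ x ≠ Sym.follower) (hb a) (hb b) (hh l₁ r₁ k₁) (hh l₂ r₂ k₂) h
      obtain ⟨h₃, h₄⟩ := ih h₂
      exact ⟨by rw [Action.encode_injective h₁, h₃], h₄⟩

/-- Different instances are written as different words. -/
theorem Instance.encode_injective : Function.Injective Instance.encode := by
  rintro ⟨n, L, F, I, G⟩ ⟨n', L', F', I', G'⟩ h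
  simp only [Instance.encode, List.append_assoc] at h
  have hs : ∀ {k : ℕ} (L F : List (Action (Fin k))),
      ∀ x ∈ (L.flatMap (fun a => Sym.leader :: a.encode) ++
        F.flatMap (fun a => Sym.follower :: a.encode)).head?, ¬ ∃ b c, x = Sym.state b c := by
    intro k L F x hx
    cases L with
    | cons a L => simp at hx; subst hx; simp
    | nil =>
      cases F with
      | nil => simp at hx
      | cons a F => simp at hx; subst hx; simp
  classical
  obtain ⟨h₁, h₂⟩ := append_inj_of_separated (fun x => ∃ b c, x = Sym.state b c)
    (by simp only [List.mem_ofFn]; rintro x ⟨v, rfl⟩; exact ⟨_, _, rfl⟩)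
    (by simp only [List.mem_ofFn]; rintro x ⟨v, rfl⟩; exact ⟨_, _, rfl⟩) (hs L F) (hs L' F') h
  obtain rfl : n = n' := by simpa using congrArg List.length h₁
  have h₃ := List.ofFn_injective h₁
  simp only [funext_iff, Sym.state.injEq, decide_eq_decide] at h₃
  obtain rfl : I = I' := Finset.ext fun v => (h₃ v).1
  obtain rfl : G = G' := Finset.ext fun v => (h₃ v).2
  have hf : ∀ F : List (Action (Fin n)),
      ∀ x ∈ (F.flatMap (fun a => Sym.follower :: a.encode)).head?,
        x ≠ Sym.leader ∧ (x = Sym.leader ∨ x = Sym.follower) := by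
    intro F x hx
    cases F with
    | nil => simp at hx
    | cons a F => simp at hx; subst hx; simp
  obtain ⟨rfl, h₄⟩ := flatMap_encode_injective Sym.leader (Or.inl rfl) (hf F) (hf F') h₂
  obtain ⟨rfl, -⟩ := flatMap_encode_injective (r₁ := []) (r₂ := []) Sym.follower (Or.inr rfl)
    (by simp) (by simp) (by simpa using h₄)
  rfl

/-- A set of instances is decidable in polynomial time: a multi-stack Turing machine outputs, in a
number of steps that is polynomial in the length of the encoded instance, whether the instance
belongs to the set. -/
def DecidableInPolyTime (L : Set Instance) : Prop :=
  open Classical in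
  Nonempty (Turing.TM2ComputableInPolyTime Instance.encode Computability.encodeBool
    (fun T => decide (T ∈ L)))

end Stackelberg

/-!
Without preconditions the follower's task is solved by backward search that never has to backtrack.
Let `R` be the set of facts that still have to hold. An action that destroys a fact of `R` (deletes
it without adding it) cannot be the last one of a plan for `R`; for any other action `a` it does no
harm to append `a`, and then only `R \ a.add` has to hold before it. Repeating this step (`regress`)
for all follower actions shrinks the goal to a set `R` that no follower action changes any more. The
follower succeeds from a state `s` iff `R ⊆ s`: if `R ⊆ s`, undoing the steps gives a plan
(`StackelbergTask.IsRegressed`), and conversely a fixed `R` that holds at the end of a plan holds at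
its beginning (`subset_of_subset_seqApply`). So the leader wins iff some fact of `R` is false
initially or is destroyed by a single leader action (`StackelbergTask.IsRegressed.sat_iff`).

The machine keeps `R` as one bit per fact and reads the input in passes. While it reads an action it
replaces every bit by a pair, the old value and the value after regression, and notes whether the
action destroys a fact of `R`; at the next marker it knows which component to keep, and puts the
bits back. During a pass it also notes whether a leader action or the initial state falsifies a fact
of `R`, and whether some action has a precondition (`run_pass`). A pass that does not change `R` is
the last one, and its notes give the answer. Every other pass removes a fact from `R`, and a pass is
linear in the length of the input, so the running time is quadratic (`run_machine`).
-/

namespace Stackelberg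

/-! ### Goal regression without preconditions -/

/-- The action has at least one precondition. -/
def Action.HasPre {V : Type} (a : Action V) : Prop := ∃ v, v ∈ a.prePos ∨ v ∈ a.preNeg

theorem Action.preCard_eq_zero_iff {V : Type} (a : Action V) : a.preCard = 0 ↔ ¬ a.HasPre := by
  simp only [preCard, HasPre, Nat.add_eq_zero_iff, Finset.card_eq_zero,
    Finset.eq_empty_iff_forall_notMem]
  constructor
  · rintro ⟨h₁, h₂⟩ ⟨v, h | h⟩
    exacts [h₁ v h, h₂ v h]
  · exact fun h => ⟨fun v hv => h ⟨v, .inl hv⟩, fun v hv => h ⟨v, .inr hv⟩⟩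

section Regression

variable {V : Type} [DecidableEq V]

/-- Executing the action makes some fact of `R` false, whatever held before; facts that are both
deleted and added come out true. -/
def Action.Destroys (a : Action V) (R : Finset V) : Prop := ∃ v ∈ R, v ∈ a.del ∧ v ∉ a.add

instance (a : Action V) (R : Finset V) : Decidable (a.Destroys R) :=
  inferInstanceAs (Decidable (∃ v ∈ R, v ∈ a.del ∧ v ∉ a.add))

/-- One step of backward search from the subgoals `R`: an action that destroys a subgoal cannot be
the last one, any other action can be put last and then takes care of the subgoals that it adds. -/
def regress (R : Finset V) (a : Action V) : Finset V :=
  if a.Destroys R then R else R \ a.add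

theorem regress_subset (R : Finset V) (a : Action V) : regress R a ⊆ R := by
  unfold regress
  split_ifs
  · rfl
  · exact Finset.sdiff_subset

theorem foldl_regress_subset (F : List (Action V)) (R : Finset V) : F.foldl regress R ⊆ R := by
  induction F generalizing R with
  | nil => rfl
  | cons a F ih => exact (ih _).trans (regress_subset R a)

theorem regress_eq_of_foldl_regress_eq {F : List (Action V)} {R : Finset V}
    (h : F.foldl regress R = R) : ∀ a ∈ F, regress R a = R := by
  induction F with
  | nil => simp
  | cons a F ih =>
    have ha : regress R a = R :=
      (regress_subset R a).antisymm (h.symm.subset.trans (foldl_regress_subset F _))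
    rw [List.foldl_cons, ha] at h
    simpa [ha] using ih h

/-- Some sequence of the actions `F` leads from `s` to a state that contains `G`. -/
def CanReach (F : List (Action V)) (s G : Finset V) : Prop :=
  ∃ π : List (Action V), (∀ a ∈ π, a ∈ F) ∧ G ⊆ seqApply π s

theorem seqApply_append (π ρ : List (Action V)) (s : Finset V) :
    seqApply (π ++ ρ) s = seqApply ρ (seqApply π s) := by
  induction π generalizing s with
  | nil => rfl
  | cons a π ih => exact ih _

theorem subset_apply_of_regress_subset {a : Action V} {R s : Finset V} (ha : ¬ a.Destroys R)
    (h : regress R a ⊆ s) : R ⊆ a.apply s := by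
  intro v hv
  by_cases hva : v ∈ a.add
  · exact Finset.mem_union_right _ hva
  · refine Finset.mem_union_left _ (Finset.mem_sdiff.2 ⟨h ?_, fun hd => ha ⟨v, hv, hd, hva⟩⟩)
    rw [regress, if_neg ha]
    exact Finset.mem_sdiff.2 ⟨hv, hva⟩

theorem CanReach.of_regress {F : List (Action V)} {a : Action V} {R s : Finset V} (ha : a ∈ F)
    (h : CanReach F s (regress R a)) : CanReach F s R := by
  obtain ⟨π, hπ, hs⟩ := h
  by_cases hd : a.Destroys R
  · exact ⟨π, hπ, by rwa [regress, if_pos hd] at hs⟩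
  · refine ⟨π ++ [a], ?_, ?_⟩
    · simp only [List.mem_append, List.mem_singleton]
      rintro b (hb | rfl)
      exacts [hπ b hb, ha]
    · rw [seqApply_append]
      exact subset_apply_of_regress_subset hd hs

theorem CanReach.of_foldl_regress {F F' : List (Action V)} (hF : F' ⊆ F) {R s : Finset V}
    (h : CanReach F s (F'.foldl regress R)) : CanReach F s R := by
  induction F' generalizing R with
  | nil => exact h
  | cons a F' ih =>
    exact (ih (fun b hb => hF (List.mem_cons_of_mem a hb)) h).of_regress (hF List.mem_cons_self)

/-- Subgoals that backward search leaves unchanged hold before every plan after which they hold. -/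
theorem subset_of_subset_seqApply {F : List (Action V)} {R : Finset V}
    (hR : ∀ a ∈ F, regress R a = R) {π : List (Action V)} (hπ : ∀ a ∈ π, a ∈ F) {s : Finset V}
    (h : R ⊆ seqApply π s) : R ⊆ s := by
  induction π generalizing s with
  | nil => exact h
  | cons a π ih =>
    have h₁ : R ⊆ a.apply s := ih (fun b hb => hπ b (List.mem_cons_of_mem a hb)) h
    have hd : ¬ a.Destroys R := by
      rintro ⟨v, hv, hdel, hadd⟩
      have := h₁ hv
      simp [Action.apply, hdel, hadd] at this
    have h₂ := hR a (hπ a List.mem_cons_self)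
    rw [regress, if_neg hd] at h₂
    intro v hv
    have h₃ := h₁ hv
    have h₄ : v ∉ a.add := by
      rw [← h₂] at hv
      exact (Finset.mem_sdiff.1 hv).2
    simp only [Action.apply, Finset.mem_union, Finset.mem_sdiff, h₄, or_false] at h₃
    exact h₃.1

/-- `R` consists of subgoals of `T` that backward search has reached from the goal. -/
structure StackelbergTask.IsRegressed (T : StackelbergTask V) (R : Finset V) : Prop where
  subset_goal : R ⊆ T.goal
  canReach : ∀ s, R ⊆ s → CanReach T.followerActions s T.goal

theorem StackelbergTask.isRegressed_goal (T : StackelbergTask V) : T.IsRegressed T.goal :=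
  ⟨subset_rfl, fun _ hs => ⟨[], by simp, hs⟩⟩

theorem StackelbergTask.IsRegressed.foldl {T : StackelbergTask V} {R : Finset V}
    (h : T.IsRegressed R) : T.IsRegressed (T.followerActions.foldl regress R) where
  subset_goal := (foldl_regress_subset _ R).trans h.subset_goal
  canReach s hs := by
    obtain ⟨π, hπ, hR⟩ := CanReach.of_foldl_regress (List.Subset.refl T.followerActions)
      (R := R) (s := s) ⟨[], by simp, hs⟩
    obtain ⟨ρ, hρ, hG⟩ := h.canReach _ hR
    refine ⟨π ++ ρ, ?_, by rwa [seqApply_append]⟩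
    simp only [List.mem_append]
    rintro a (ha | ha)
    exacts [hπ a ha, hρ a ha]

theorem seqApplicable_of_not_hasPre {π : List (Action V)} (h : ∀ a ∈ π, ¬ a.HasPre)
    (s : Finset V) : SeqApplicable π s := by
  induction π generalizing s with
  | nil => trivial
  | cons a π ih =>
    have ha := h a List.mem_cons_self
    refine ⟨⟨fun v hv => (ha ⟨v, .inl hv⟩).elim, Finset.disjoint_left.2 fun v hv => ?_⟩,
      ih (fun b hb => h b (List.mem_cons_of_mem a hb)) _⟩
    exact (ha ⟨v, .inr hv⟩).elim

/-- Facts that hold at first and fail after a sequence have been destroyed by one of its actions,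
which destroys them in any other state as well. -/
theorem exists_destroys_of_not_subset_seqApply {R : Finset V} {π : List (Action V)}
    {s : Finset V} (hs : R ⊆ s) (h : ¬ R ⊆ seqApply π s) : ∃ a ∈ π, a.Destroys R := by
  induction π generalizing s with
  | nil => exact (h hs).elim
  | cons a π ih =>
    by_cases ha : a.Destroys R
    · exact ⟨a, List.mem_cons_self, ha⟩
    · obtain ⟨b, hb, hd⟩ := ih
        (subset_apply_of_regress_subset ha ((regress_subset R a).trans hs)) h
      exact ⟨b, List.mem_cons_of_mem a hb, hd⟩

/-- Once backward search is complete, its subgoals are exactly what the follower needs, so the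
leader wins iff one of them is false at the outset or can be destroyed by a single action. -/
theorem StackelbergTask.IsRegressed.sat_iff {T : StackelbergTask V} {R : Finset V}
    (h : T.IsRegressed R) (hR : ∀ a ∈ T.followerActions, regress R a = R)
    (hL : ∀ a ∈ T.leaderActions, ¬ a.HasPre) (hF : ∀ a ∈ T.followerActions, ¬ a.HasPre) :
    T.Sat ↔ (∃ v ∈ R, v ∉ T.init) ∨ ∃ a ∈ T.leaderActions, a.Destroys R := by
  have key : ∀ π, (T.followerTask π).Unsolvable ↔ ¬ R ⊆ seqApply π T.init := by
    intro π
    refine not_congr ⟨?_, fun hs => ?_⟩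
    · rintro ⟨ρ, hρ, -, hG⟩
      exact subset_of_subset_seqApply hR hρ (h.subset_goal.trans hG)
    · obtain ⟨ρ, hρ, hG⟩ := h.canReach _ hs
      exact ⟨ρ, hρ, seqApplicable_of_not_hasPre (fun a ha => hF a (hρ a ha)) _, hG⟩
  simp only [Sat, key]
  constructor
  · rintro ⟨π, ⟨hπ, -⟩, hs⟩
    by_cases hi : R ⊆ T.init
    · obtain ⟨a, ha, hd⟩ := exists_destroys_of_not_subset_seqApply hi hs
      exact .inr ⟨a, hπ a ha, hd⟩
    · exact .inl (Finset.not_subset.1 hi)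
  · rintro (hi | ⟨a, ha, v, hv, hdel, hadd⟩)
    · exact ⟨[], ⟨by simp, trivial⟩, Finset.not_subset.2 hi⟩
    · refine ⟨[a], ⟨by simpa using ha, seqApplicable_of_not_hasPre (by simpa using hL a ha) _⟩,
        fun hs => ?_⟩
      have := hs hv
      simp [seqApply, Action.apply, hdel, hadd] at this

end Regression

/-! ### The machine -/

/-- The stacks of the machine. -/
inductive Stack : Type
  /-- the unread part of the input -/
  | input
  /-- the part of the input that has been read in the current pass, in reverse -/
  | done
  /-- one bit per fact, telling whether it is still a subgoal -/
  | mem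
  /-- the bits taken from `mem` for the current action, in reverse, each one with the value
  that it takes if the action is regressed through -/
  | pairs
  /-- the output -/
  | output
  deriving DecidableEq

instance : Fintype Stack :=
  ⟨{.input, .done, .mem, .pairs, .output}, fun k => by cases k <;> decide⟩

/-- The alphabet of each stack. -/
abbrev Stack.Alphabet : Stack → Type
  | input => Sym
  | done => Sym
  | mem => Bool
  | pairs => Bool × Bool
  | output => Bool

/-- What the machine remembers of the current pass over the input. -/
structure Flags : Type where
  /-- some action read so far has a precondition -/
  pre : Bool
  /-- some subgoal is false initially or can be destroyed by the leader -/
  acc : Bool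
  /-- the subgoals must not be regressed through what is being read: it is not a follower action,
  or it destroys a subgoal -/
  blocked : Bool
  /-- the subgoals have changed -/
  changed : Bool
  /-- a leader action is being read -/
  leader : Bool
  deriving Fintype

/-- The flags at the start of a pass. -/
def Flags.start : Flags := ⟨false, false, true, false, false⟩

/-- The internal state: the flags and buffers for symbols taken from the stacks. -/
structure Reg : Type where
  fl : Flags
  sym : Option Sym
  cell : Option (Bool × Bool)
  deriving Fintype

/-- The labels of the machine's program. -/
inductive Label : Type
  /-- read the next symbol of the input -/
  | scan
  /-- move the contents of `Stack.pairs` back to `Stack.mem` -/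
  | flush
  /-- move the input back in order to start another pass -/
  | rewind
  /-- empty the stacks and output the answer -/
  | clean
  deriving DecidableEq

instance : Fintype Label :=
  ⟨{.scan, .flush, .rewind, .clean}, fun l => by cases l <;> decide⟩

/-- The symbol describes a fact, in the initial state and goal or in an action. -/
def isEntry : Option Sym → Bool
  | some (.state _ _) => true
  | some (.fact _ _ _ _) => true
  | _ => false

def isCostBit : Option Sym → Bool
  | some (.costBit _) => true
  | _ => false

/-- Processes the entry of one fact, given the bit stored for that fact. In the very first pass no
bit is stored when the initial state and goal are read, and the goal provides it. -/
def Reg.readEntry (r : Reg) (c : Option Bool) : Reg :=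
  match r.sym with
  | some (.state i g) =>
    { r with
      cell := some (c.getD g, c.getD g)
      fl := { r.fl with acc := r.fl.acc || (c.getD g && !i) } }
  | some (.fact p q a d) =>
    let b := c.getD false
    { r with
      cell := some (b, b && !a)
      fl := { r.fl with
        pre := r.fl.pre || (p || q)
        acc := r.fl.acc || (r.fl.leader && (b && d && !a))
        blocked := r.fl.blocked || (b && d && !a) } }
  | _ => r

/-- The bit to be stored after an action has been read. -/
def Flags.select (f : Flags) (p : Bool × Bool) : Bool := if f.blocked then p.1 else p.2

/-- The flags at the start of an action with the marker `s`. -/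
def Flags.startAction (f : Flags) (s : Option Sym) : Flags :=
  { f with
    blocked := decide (s = some .leader)
    leader := decide (s = some .leader) }

open Turing.TM2.Stmt in
/-- The program of the machine. -/
def program : Label → Turing.TM2.Stmt Stack.Alphabet Label Reg
  | .scan =>
    pop .input (fun r s => { r with sym := s }) <|
    branch (fun r => isEntry r.sym)
      (pop .mem Reg.readEntry <|
       push .pairs (fun r => r.cell.getD default) <|
       push .done (fun r => r.sym.getD .leader) <|
       load (fun r => ⟨r.fl, none, none⟩) <|
       goto fun _ => .scan) <|
    branch (fun r => isCostBit r.sym)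
      (push .done (fun r => r.sym.getD .leader) <|
       load (fun r => ⟨r.fl, none, none⟩) <|
       goto fun _ => .scan)
      (goto fun _ => .flush)
  | .flush =>
    pop .pairs (fun r p => { r with cell := p }) <|
    branch (fun r => r.cell.isSome)
      (push .mem (fun r => r.fl.select (r.cell.getD default)) <|
       load (fun r =>
         let p := r.cell.getD default
         ⟨{ r.fl with changed := r.fl.changed || (!r.fl.blocked && p.1 != p.2) }, r.sym, none⟩) <|
       goto fun _ => .flush) <|
    branch (fun r => r.sym.isSome)
      (push .done (fun r => r.sym.getD .leader) <|
       load (fun r => ⟨r.fl.startAction r.sym, none, none⟩) <|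
       goto fun _ => .scan)
      (goto fun r => if r.fl.changed then .rewind else .clean)
  | .rewind =>
    pop .done (fun r s => { r with sym := s }) <|
    branch (fun r => r.sym.isSome)
      (push .input (fun r => r.sym.getD .leader) <|
       load (fun r => ⟨r.fl, none, none⟩) <|
       goto fun _ => .rewind)
      (load (fun _ => ⟨Flags.start, none, none⟩) <|
       goto fun _ => .scan)
  | .clean =>
    pop .done (fun r s => { r with sym := s }) <|
    pop .mem (fun r b => { r with cell := b.map fun b => (b, b) }) <|
    branch (fun r => r.sym.isSome || r.cell.isSome)
      (load (fun r => ⟨r.fl, none, none⟩) <|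
       goto fun _ => .clean)
      (push .output (fun r => r.fl.acc && !r.fl.pre) <|
       load (fun _ => ⟨Flags.start, none, none⟩)
       halt)

/-- The machine that decides `STACKELSAT` for tasks without preconditions. -/
def machine : Turing.FinTM2 where
  K := Stack
  k₀ := .input
  k₁ := .output
  Γ := Stack.Alphabet
  Λ := Label
  main := .scan
  σ := Reg
  initialState := ⟨Flags.start, none, none⟩
  Γk₀Fin := inferInstanceAs (Fintype Sym)
  m := program

/-- The configuration with the given stacks and nothing on the output stack. -/
def cfg (l : Label) (r : Reg) (i d : List Sym) (m : List Bool) (p : List (Bool × Bool)) :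
    machine.Cfg where
  l := some l
  var := r
  stk
    | .input => i
    | .done => d
    | .mem => m
    | .pairs => p
    | .output => []

/-- The machine gets from one configuration to another in at most `n` steps. -/
def Run (n : ℕ) (c c' : machine.Cfg) : Prop :=
  Nonempty (StateTransition.EvalsToInTime machine.step c (some c') n)

theorem Run.refl (c : machine.Cfg) : Run 0 c c := ⟨.refl _ _⟩

theorem Run.trans {m n : ℕ} {a b c : machine.Cfg} (h₁ : Run m a b) (h₂ : Run n b c) :
    Run (m + n) a c := by
  obtain ⟨h₁⟩ := h₁
  obtain ⟨h₂⟩ := h₂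
  exact ⟨Nat.add_comm m n ▸ h₁.trans _ m n a b (some c) h₂⟩

theorem Run.mono {m n : ℕ} {a b : machine.Cfg} (h : Run m a b) (hmn : m ≤ n) : Run n a b := by
  obtain ⟨h⟩ := h
  exact ⟨⟨h.toEvalsTo, h.steps_le_m.trans hmn⟩⟩

theorem Run.congr {n : ℕ} {a b b' : machine.Cfg} (h : Run n a b) (hb : b = b') : Run n a b' :=
  hb ▸ h

theorem Run.single {a b : machine.Cfg} (h : machine.step a = some b) : Run 1 a b :=
  ⟨⟨⟨1, h⟩, le_rfl⟩⟩

theorem Run.head {n : ℕ} {a b c : machine.Cfg} (h₁ : machine.step a = some b) (h₂ : Run n b c) :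
    Run (n + 1) a c :=
  ((Run.single h₁).trans h₂).mono (Nat.add_comm 1 n).le

theorem cfg_ext {c c' : machine.Cfg} (hl : c.l = c'.l) (hv : c.var = c'.var)
    (hs : ∀ k : Stack, c.stk k = c'.stk k) : c = c' := by
  obtain ⟨l, v, s⟩ := c
  obtain ⟨l', v', s'⟩ := c'
  obtain rfl : l = l' := hl
  obtain rfl : v = v' := hv
  obtain rfl : s = s' := funext hs
  rfl

theorem step_state (f : Flags) (i g : Bool) (inp d : List Sym) (m : List Bool)
    (p : List (Bool × Bool)) :
    machine.step (cfg .scan ⟨f, none, none⟩ (.state i g :: inp) d m p) =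
      some (cfg .scan ⟨{ f with acc := f.acc || (m.head?.getD g && !i) }, none, none⟩
        inp (.state i g :: d) m.tail ((m.head?.getD g, m.head?.getD g) :: p)) := by
  refine congrArg some (cfg_ext rfl rfl fun k => ?_)
  cases k <;> rfl

theorem step_fact (f : Flags) (p q a e b : Bool) (inp d : List Sym) (m : List Bool)
    (ps : List (Bool × Bool)) :
    machine.step (cfg .scan ⟨f, none, none⟩ (.fact p q a e :: inp) d (b :: m) ps) =
      some (cfg .scan ⟨{ f with
          pre := f.pre || (p || q)
          acc := f.acc || (f.leader && (b && e && !a))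
          blocked := f.blocked || (b && e && !a) }, none, none⟩
        inp (.fact p q a e :: d) m ((b, b && !a) :: ps)) := by
  refine congrArg some (cfg_ext rfl rfl fun k => ?_)
  cases k <;> rfl

theorem step_costBit (f : Flags) (b : Bool) (inp d : List Sym) (m : List Bool)
    (p : List (Bool × Bool)) :
    machine.step (cfg .scan ⟨f, none, none⟩ (.costBit b :: inp) d m p) =
      some (cfg .scan ⟨f, none, none⟩ inp (.costBit b :: d) m p) := by
  refine congrArg some (cfg_ext rfl rfl fun k => ?_)
  cases k <;> rfl

theorem step_marker (f : Flags) (s : Sym) (hs : s = .leader ∨ s = .follower) (inp d : List Sym)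
    (m : List Bool) (p : List (Bool × Bool)) :
    machine.step (cfg .scan ⟨f, none, none⟩ (s :: inp) d m p) =
      some (cfg .flush ⟨f, some s, none⟩ inp d m p) := by
  refine congrArg some (cfg_ext ?_ ?_ fun k => ?_) <;> rcases hs with rfl | rfl
  any_goals rfl
  all_goals cases k <;> rfl

theorem step_end (f : Flags) (d : List Sym) (m : List Bool) (p : List (Bool × Bool)) :
    machine.step (cfg .scan ⟨f, none, none⟩ [] d m p) =
      some (cfg .flush ⟨f, none, none⟩ [] d m p) := by
  refine congrArg some (cfg_ext rfl rfl fun k => ?_)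
  cases k <;> rfl

theorem step_flush_cons (f : Flags) (s : Option Sym) (inp d : List Sym) (m : List Bool)
    (x : Bool × Bool) (p : List (Bool × Bool)) :
    machine.step (cfg .flush ⟨f, s, none⟩ inp d m (x :: p)) =
      some (cfg .flush ⟨{ f with changed := f.changed || (!f.blocked && x.1 != x.2) }, s, none⟩
        inp d (f.select x :: m) p) := by
  refine congrArg some (cfg_ext rfl rfl fun k => ?_)
  cases k <;> rfl

theorem step_flush_marker (f : Flags) (s : Sym) (inp d : List Sym) (m : List Bool) :
    machine.step (cfg .flush ⟨f, some s, none⟩ inp d m []) =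
      some (cfg .scan ⟨f.startAction (some s), none, none⟩ inp (s :: d) m []) := by
  refine congrArg some (cfg_ext rfl rfl fun k => ?_)
  cases k <;> rfl

theorem step_flush_end (f : Flags) (inp d : List Sym) (m : List Bool) :
    machine.step (cfg .flush ⟨f, none, none⟩ inp d m []) =
      some (cfg (if f.changed then .rewind else .clean) ⟨f, none, none⟩ inp d m []) := by
  refine congrArg some (cfg_ext rfl rfl fun k => ?_)
  cases k <;> rfl

theorem step_rewind_cons (f : Flags) (s : Sym) (inp d : List Sym) (m : List Bool)
    (p : List (Bool × Bool)) :
    machine.step (cfg .rewind ⟨f, none, none⟩ inp (s :: d) m p) =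
      some (cfg .rewind ⟨f, none, none⟩ (s :: inp) d m p) := by
  refine congrArg some (cfg_ext rfl rfl fun k => ?_)
  cases k <;> rfl

theorem step_rewind_nil (f : Flags) (inp : List Sym) (m : List Bool) (p : List (Bool × Bool)) :
    machine.step (cfg .rewind ⟨f, none, none⟩ inp [] m p) =
      some (cfg .scan ⟨.start, none, none⟩ inp [] m p) := by
  refine congrArg some (cfg_ext rfl rfl fun k => ?_)
  cases k <;> rfl

theorem step_clean (f : Flags) (inp d : List Sym) (m : List Bool) (p : List (Bool × Bool))
    (h : ¬ (d = [] ∧ m = [])) :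
    machine.step (cfg .clean ⟨f, none, none⟩ inp d m p) =
      some (cfg .clean ⟨f, none, none⟩ inp d.tail m.tail p) := by
  refine congrArg some (cfg_ext ?_ ?_ fun k => ?_) <;>
    (try cases k) <;> cases d <;> cases m <;> first | rfl | simp at h

theorem step_clean_nil (f : Flags) :
    machine.step (cfg .clean ⟨f, none, none⟩ [] [] [] []) =
      some (Turing.haltList machine [f.acc && !f.pre]) := by
  refine congrArg some (cfg_ext rfl rfl fun k => ?_)
  cases k <;> rfl

theorem initList_eq (w : List Sym) :
    Turing.initList machine w = cfg .scan ⟨.start, none, none⟩ w [] [] [] := by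
  refine cfg_ext rfl rfl fun k => ?_
  cases k <;> rfl

/-! ### Runs of the machine -/

section Run

variable {V : Type} [DecidableEq V]

/-- The entry of a fact in the description of an action. -/
def Action.entry (a : Action V) (v : V) : Sym :=
  .fact (decide (v ∈ a.prePos)) (decide (v ∈ a.preNeg)) (decide (v ∈ a.add)) (decide (v ∈ a.del))

/-- The bits stored for the facts in `l`. -/
def bits (l : List V) (R : Finset V) : List Bool := l.map fun v => decide (v ∈ R)

/-- The pairs of bits stored for the facts in `l`, on top of `p`. -/
def pairBits (l : List V) (R N : Finset V) (p : List (Bool × Bool)) : List (Bool × Bool) :=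
  (l.map fun v => (decide (v ∈ R), decide (v ∈ N))).reverse ++ p

/-- Reading the entries of an action turns the stored bits of `R` into pairs of the bits of `R` and
`R \ a.add`, and notes preconditions and destroyed facts. -/
theorem run_entries (a : Action V) (R : Finset V) (l : List V) (f : Flags) (inp d : List Sym)
    (p : List (Bool × Bool)) :
    Run l.length
      (cfg .scan ⟨f, none, none⟩ (l.map a.entry ++ inp) d (bits l R) p)
      (cfg .scan ⟨{ f with
          pre := f.pre || l.any fun v => decide (v ∈ a.prePos ∨ v ∈ a.preNeg)
          acc := f.acc || (f.leader && l.any fun v => decide (v ∈ R ∧ v ∈ a.del ∧ v ∉ a.add))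
          blocked := f.blocked || l.any fun v => decide (v ∈ R ∧ v ∈ a.del ∧ v ∉ a.add) },
          none, none⟩
        inp ((l.map a.entry).reverse ++ d) [] (pairBits l R (R \ a.add) p)) := by
  induction l generalizing f d p with
  | nil => simpa [bits, pairBits] using Run.refl _
  | cons v l ih =>
    refine Run.head (step_fact f _ _ _ _ _ _ _ _ _) ?_
    refine (ih _ _ _).congr ?_
    simp [Action.entry, pairBits, Bool.or_assoc, Bool.and_assoc, Bool.and_or_distrib_left]

/-- The description of the initial state and the goal is read in the same way in all passes. The
stored bits `M l` for the facts `l` are missing (`M l = []`) in the first pass, where the goal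
provides them, and present in the later ones. -/
theorem run_states (I G R : Finset V) (M : List V → List Bool)
    (hM : (∀ l, M l = []) ∧ R = G ∨ ∀ l, M l = bits l R) (l : List V) (f : Flags)
    (inp d : List Sym) (p : List (Bool × Bool)) :
    Run l.length
      (cfg .scan ⟨f, none, none⟩
        (l.map (fun v => .state (decide (v ∈ I)) (decide (v ∈ G))) ++ inp) d (M l) p)
      (cfg .scan ⟨{ f with acc := f.acc || l.any fun v => decide (v ∈ R ∧ v ∉ I) }, none, none⟩
        inp ((l.map (fun v => Sym.state (decide (v ∈ I)) (decide (v ∈ G)))).reverse ++ d) []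
        (pairBits l R R p)) := by
  induction l generalizing f d p with
  | nil =>
    have : M [] = [] := by
      rcases hM with ⟨h, -⟩ | h <;> simp [h, bits]
    simpa [this, pairBits] using Run.refl _
  | cons v l ih =>
    have hb : (M (v :: l)).head?.getD (decide (v ∈ G)) = decide (v ∈ R) := by
      rcases hM with ⟨h, rfl⟩ | h <;> simp [h, bits]
    have ht : (M (v :: l)).tail = M l := by
      rcases hM with ⟨h, -⟩ | h <;> simp [h, bits]
    refine Run.head (step_state f _ _ _ _ _ _) ?_
    rw [hb, ht]
    refine (ih _ _ _).congr ?_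
    simp [pairBits, Bool.or_assoc]

theorem run_costBits (c : List Bool) (f : Flags) (inp d : List Sym) (m : List Bool)
    (p : List (Bool × Bool)) :
    Run c.length (cfg .scan ⟨f, none, none⟩ (c.map Sym.costBit ++ inp) d m p)
      (cfg .scan ⟨f, none, none⟩ inp ((c.map Sym.costBit).reverse ++ d) m p) := by
  induction c generalizing d with
  | nil => exact Run.refl _
  | cons b c ih =>
    refine Run.head (step_costBit f _ _ _ _ _) ?_
    simpa using ih _

theorem run_flush (p : List (Bool × Bool)) (f : Flags) (s : Option Sym) (inp d : List Sym)
    (m : List Bool) :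
    Run p.length (cfg .flush ⟨f, s, none⟩ inp d m p)
      (cfg .flush
        ⟨{ f with changed := f.changed || (!f.blocked && p.any fun x => x.1 != x.2) }, s, none⟩
        inp d ((p.map f.select).reverse ++ m) []) := by
  induction p generalizing f m with
  | nil => simpa using Run.refl _
  | cons x p ih =>
    refine Run.head (step_flush_cons f _ _ _ _ _ _) ?_
    refine (ih _ _).congr ?_
    simp [Bool.or_assoc, Bool.and_or_distrib_left, Flags.select]
    rfl

theorem run_rewind (d : List Sym) (f : Flags) (inp : List Sym) (m : List Bool)
    (p : List (Bool × Bool)) :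
    Run (d.length + 1) (cfg .rewind ⟨f, none, none⟩ inp d m p)
      (cfg .scan ⟨.start, none, none⟩ (d.reverse ++ inp) [] m p) := by
  induction d generalizing inp with
  | nil => exact Run.single (step_rewind_nil f _ _ _)
  | cons s d ih =>
    refine Run.head (step_rewind_cons f _ _ _ _ _) ?_
    simpa using ih _

/-- The stacks `done` and `mem` are emptied simultaneously; `k` bounds both. -/
theorem run_clean (k : ℕ) (f : Flags) (d : List Sym) (m : List Bool) (hd : d.length ≤ k)
    (hm : m.length ≤ k) :
    Run (k + 1) (cfg .clean ⟨f, none, none⟩ [] d m [])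
      (Turing.haltList machine [f.acc && !f.pre]) := by
  induction k generalizing d m with
  | zero =>
    obtain rfl := List.length_eq_zero_iff.1 (Nat.le_zero.1 hd)
    obtain rfl := List.length_eq_zero_iff.1 (Nat.le_zero.1 hm)
    exact Run.single (step_clean_nil f)
  | succ k ih =>
    by_cases h : d = [] ∧ m = []
    · obtain ⟨rfl, rfl⟩ := h
      exact (Run.single (step_clean_nil f)).mono (by omega)
    · refine Run.head (step_clean f _ _ _ _ h) (ih _ _ ?_ ?_) <;> rw [List.length_tail] <;> omega

end Run

section Pass

variable {n : ℕ}

/-- The subgoals that are stored once the stack of pairs, which holds the values `R` and `N`, has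
been moved back. -/
def current (f : Flags) (R N : Finset (Fin n)) : Finset (Fin n) := if f.blocked then R else N

/-- Moving back the stack of pairs, which holds the values `R` and `N`, leaves the machine with the
information that the subgoals have changed. -/
def pending (f : Flags) (R N : Finset (Fin n)) : Bool :=
  f.changed || (!f.blocked && decide (R ≠ N))

/-- The configuration between two actions: the pairs for all facts, with the values `R` and `N`,
have not been moved back yet. -/
def boundary (f : Flags) (R N : Finset (Fin n)) (inp d : List Sym) : machine.Cfg :=
  cfg .scan ⟨f, none, none⟩ inp d [] (pairBits (List.finRange n) R N [])

/-- Moving back the pairs of all facts decides between the values `R` and `N`. -/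
theorem run_flush_pairBits (f : Flags) (R N : Finset (Fin n)) (s : Option Sym)
    (inp d : List Sym) :
    Run n
      (cfg .flush ⟨f, s, none⟩ inp d [] (pairBits (List.finRange n) R N []))
      (cfg .flush ⟨{ f with changed := pending f R N }, s, none⟩ inp d
        (bits (List.finRange n) (current f R N)) []) := by
  have h := run_flush (pairBits (List.finRange n) R N []) f s inp d []
  convert h using 2
  · simp [pairBits]
  · congr 2
    simp only [pending, pairBits, List.append_nil, List.any_reverse, List.any_map]
    congr 2
    rw [Bool.eq_iff_iff]
    simp [Finset.ext_iff]
  · cases hb : f.blocked <;>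
      simp [bits, pairBits, current, Flags.select, hb, Function.comp_def]

theorem finRange_any_destroys (a : Action (Fin n)) (R : Finset (Fin n)) :
    ((List.finRange n).any fun v => decide (v ∈ R ∧ v ∈ a.del ∧ v ∉ a.add)) =
      decide (a.Destroys R) := by
  rw [Bool.eq_iff_iff, decide_eq_true_iff]
  simp [Action.Destroys]

instance (a : Action (Fin n)) : Decidable a.HasPre :=
  inferInstanceAs (Decidable (∃ v, v ∈ a.prePos ∨ v ∈ a.preNeg))

theorem finRange_any_hasPre (a : Action (Fin n)) :
    ((List.finRange n).any fun v => decide (v ∈ a.prePos ∨ v ∈ a.preNeg)) =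
      decide a.HasPre := by
  rw [Bool.eq_iff_iff, decide_eq_true_iff]
  simp [Action.HasPre]

/-- The flags after the action `a` has been read. -/
def Flags.afterAction (f : Flags) (ld : Bool) (a : Action (Fin n)) (R N : Finset (Fin n)) :
    Flags where
  pre := f.pre || decide a.HasPre
  acc := f.acc || (ld && decide (a.Destroys (current f R N)))
  blocked := ld || decide (a.Destroys (current f R N))
  changed := pending f R N
  leader := ld

theorem encode_eq (a : Action (Fin n)) :
    a.encode = (List.finRange n).map a.entry ++
      (Computability.encodeNat a.cost).map Sym.costBit := by
  rw [Action.encode, List.ofFn_eq_map]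
  rfl

theorem run_actionBody (a : Action (Fin n)) (f : Flags) (R : Finset (Fin n))
    (inp d : List Sym) :
    Run a.encode.length
      (cfg .scan ⟨f, none, none⟩ (a.encode ++ inp) d (bits (List.finRange n) R) [])
      (boundary { f with
          pre := f.pre || decide a.HasPre
          acc := f.acc || (f.leader && decide (a.Destroys R))
          blocked := f.blocked || decide (a.Destroys R) }
        R (R \ a.add) inp (a.encode.reverse ++ d)) := by
  have h := (run_entries a R (List.finRange n) f
    ((Computability.encodeNat a.cost).map Sym.costBit ++ inp) d []).trans
    (run_costBits _ _ inp _ _ _)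
  rw [finRange_any_destroys, finRange_any_hasPre] at h
  simpa [boundary, encode_eq] using h

/-- From one action to the next one: the pairs left by the previous action are moved back, which
takes no longer than reading the entries of this one. -/
theorem run_action (ld : Bool) (a : Action (Fin n)) (f : Flags) (R N : Finset (Fin n))
    (inp d : List Sym) :
    Run (2 * (a.encode.length + 1))
      (boundary f R N ((bif ld then .leader else .follower) :: (a.encode ++ inp)) d)
      (boundary (f.afterAction ld a R N) (current f R N) (current f R N \ a.add) inp
        (((bif ld then .leader else .follower) :: a.encode).reverse ++ d)) := by
  have h₁ := Run.single (step_marker f (bif ld then .leader else .follower)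
    (by cases ld <;> simp) (a.encode ++ inp) d [] (pairBits (List.finRange n) R N []))
  have h₂ := run_flush_pairBits f R N (some (bif ld then .leader else .follower))
    (a.encode ++ inp) d
  have h₃ := Run.single (step_flush_marker { f with changed := pending f R N }
    (bif ld then .leader else .follower) (a.encode ++ inp) d
    (bits (List.finRange n) (current f R N)))
  have hlen : a.encode.length = n + (Computability.encodeNat a.cost).length := by
    simp [encode_eq]
  refine Run.mono ((((h₁.trans h₂).trans h₃).trans (run_actionBody a _ _ inp _)).congr ?_)
    (by omega)
  cases ld <;> simp [Flags.afterAction, Flags.startAction]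

/-- Leader actions are read with `blocked` set, so they leave the subgoals alone. -/
theorem run_leaders (L : List (Action (Fin n))) (f : Flags) (R N : Finset (Fin n))
    (hf : f.blocked = true) (inp d : List Sym) :
    ∃ (f' : Flags) (N' : Finset (Fin n)),
      Run (2 * (L.flatMap fun a => Sym.leader :: a.encode).length)
        (boundary f R N ((L.flatMap fun a => Sym.leader :: a.encode) ++ inp) d)
        (boundary f' R N' inp ((L.flatMap fun a => Sym.leader :: a.encode).reverse ++ d)) ∧
      f'.blocked = true ∧ f'.changed = f.changed ∧
      f'.pre = (f.pre || L.any fun a => decide a.HasPre) ∧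
      f'.acc = (f.acc || L.any fun a => decide (a.Destroys R)) := by
  induction L generalizing f N d with
  | nil => exact ⟨f, N, by simpa using Run.refl _, hf, rfl, by simp, by simp⟩
  | cons a L ih =>
    have hc : current f R N = R := by simp [current, hf]
    have h := run_action true a f R N ((L.flatMap fun a => Sym.leader :: a.encode) ++ inp) d
    rw [hc] at h
    obtain ⟨f', N', h₁, h₂, h₃, h₄, h₅⟩ := ih (f.afterAction true a R N) (R \ a.add) rfl
      ((Sym.leader :: a.encode).reverse ++ d)
    refine ⟨f', N', ?_, h₂, ?_, ?_, ?_⟩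
    · have h' := (h.trans h₁).mono (n := 2 * ((a :: L).flatMap fun a =>
        Sym.leader :: a.encode).length) (by simp; omega)
      simpa using h'
    · rw [h₃]
      simp [Flags.afterAction, pending, hf]
    · rw [h₄]
      simp [Flags.afterAction, Bool.or_assoc]
    · rw [h₅]
      simp [Flags.afterAction, hc, Bool.or_assoc]

/-- Follower actions regress the subgoals one after the other. Since regression only removes
subgoals, nothing has changed at the end iff no single action has changed anything. -/
theorem run_followers (F : List (Action (Fin n))) (f : Flags) (R N : Finset (Fin n))
    (inp d : List Sym) :
    ∃ (f' : Flags) (R' N' : Finset (Fin n)),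
      Run (2 * (F.flatMap fun a => Sym.follower :: a.encode).length)
        (boundary f R N ((F.flatMap fun a => Sym.follower :: a.encode) ++ inp) d)
        (boundary f' R' N' inp ((F.flatMap fun a => Sym.follower :: a.encode).reverse ++ d)) ∧
      current f' R' N' = F.foldl regress (current f R N) ∧
      (pending f' R' N' = false ↔ pending f R N = false ∧
        F.foldl regress (current f R N) = current f R N) ∧
      f'.pre = (f.pre || F.any fun a => decide a.HasPre) ∧
      f'.acc = f.acc := by
  induction F generalizing f R N d with
  | nil => exact ⟨f, R, N, by simpa using Run.refl _, rfl, by simp, by simp, rfl⟩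
  | cons a F ih =>
    have h := run_action false a f R N ((F.flatMap fun a => Sym.follower :: a.encode) ++ inp) d
    set E := current f R N with hE
    obtain ⟨f', R', N', h₁, h₂, h₃, h₄, h₅⟩ := ih (f.afterAction false a R N) E (E \ a.add)
      ((Sym.follower :: a.encode).reverse ++ d)
    have hc : current (f.afterAction false a R N) E (E \ a.add) = regress E a := by
      have hb : (f.afterAction false a R N).blocked = decide (a.Destroys E) := by
        simp [Flags.afterAction, hE]
      simp [current, hb, regress]
    have hp : pending (f.afterAction false a R N) E (E \ a.add) = false ↔
        pending f R N = false ∧ regress E a = E := by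
      by_cases hd : a.Destroys E <;>
        simp [pending, Flags.afterAction, regress, ← hE, hd, eq_comm (a := E)]
    rw [hc] at h₂ h₃
    rw [hp] at h₃
    refine ⟨f', R', N', ?_, h₂, ?_, ?_, ?_⟩
    · have h' := (h.trans h₁).mono (n := 2 * ((a :: F).flatMap fun a =>
        Sym.follower :: a.encode).length) (by simp; omega)
      simpa using h'
    · rw [h₃, List.foldl_cons, and_assoc]
      refine and_congr_right fun _ => ⟨fun ⟨h₆, h₇⟩ => by rwa [h₆] at h₇ ⊢, fun h₆ => ?_⟩
      have h₇ : regress E a = E :=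
        regress_eq_of_foldl_regress_eq (F := a :: F) h₆ a List.mem_cons_self
      exact ⟨h₇, by rwa [h₇] at h₆ ⊢⟩
    · rw [h₄]
      simp [Flags.afterAction, Bool.or_assoc]
    · rw [h₅]
      simp [Flags.afterAction]

end Pass

/-! ### Correctness and running time -/

theorem Instance.encode_eq (T : Instance) :
    T.encode = (List.finRange T.numFacts).map
        (fun v => Sym.state (decide (v ∈ T.task.init)) (decide (v ∈ T.task.goal))) ++
      ((T.task.leaderActions.flatMap fun a => Sym.leader :: a.encode) ++
      (T.task.followerActions.flatMap fun a => Sym.follower :: a.encode)) := by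
  rw [Instance.encode, List.ofFn_eq_map, List.append_assoc]

theorem Instance.numFacts_le (T : Instance) : T.numFacts ≤ T.encode.length := by
  simp [Instance.encode]

/-- One pass over the input regresses the stored subgoals once through every follower action. -/
theorem run_pass (T : Instance) (R : Finset (Fin T.numFacts))
    (M : List (Fin T.numFacts) → List Bool)
    (hM : (∀ l, M l = []) ∧ R = T.task.goal ∨ ∀ l, M l = bits l R) :
    ∃ f : Flags,
      Run (3 * T.encode.length + 2)
        (cfg .scan ⟨.start, none, none⟩ T.encode [] (M (List.finRange _)) [])
        (cfg (if f.changed then .rewind else .clean) ⟨f, none, none⟩ [] T.encode.reverse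
          (bits (List.finRange _) (T.task.followerActions.foldl regress R)) []) ∧
      (f.changed = false ↔ T.task.followerActions.foldl regress R = R) ∧
      (f.pre = true ↔ ∃ a ∈ T.task.leaderActions ++ T.task.followerActions, a.HasPre) ∧
      (f.acc = true ↔
        (∃ v ∈ R, v ∉ T.task.init) ∨ ∃ a ∈ T.task.leaderActions, a.Destroys R) := by
  set F := T.task.followerActions
  set L := T.task.leaderActions
  have h₀ := run_states T.task.init T.task.goal R M hM (List.finRange T.numFacts) .start
    ((L.flatMap fun a => Sym.leader :: a.encode) ++ (F.flatMap fun a => Sym.follower :: a.encode))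
    [] []
  rw [← Instance.encode_eq] at h₀
  obtain ⟨f₁, N₁, h₁, hb₁, hc₁, hp₁, ha₁⟩ := run_leaders L
    { Flags.start with
      acc := (List.finRange T.numFacts).any fun v => decide (v ∈ R ∧ v ∉ T.task.init) } R R rfl
    (F.flatMap fun a => Sym.follower :: a.encode) _
  have hcur : current f₁ R N₁ = R := by simp [current, hb₁]
  have hpend : pending f₁ R N₁ = false := by simp [pending, hb₁, hc₁, Flags.start]
  obtain ⟨f₂, R₂, N₂, h₂, hR₂, hc₂, hp₂, ha₂⟩ := run_followers F f₁ R N₁ [] _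
  rw [List.append_nil] at h₂
  rw [hcur] at hR₂ hc₂
  have h₃ := run_flush_pairBits f₂ R₂ N₂ none []
  refine ⟨{ f₂ with changed := pending f₂ R₂ N₂ }, ?_, ?_, ?_, ?_⟩
  · have h := ((((h₀.trans h₁).trans h₂).trans (Run.single (step_end f₂ _ _ _))).trans
      (h₃ _)).trans (Run.single (step_flush_end _ _ _ _))
    rw [hR₂] at h
    refine (h.congr ?_).mono ?_
    · simp [Instance.encode_eq, F, L]
    · have := T.numFacts_le
      have := congrArg List.length T.encode_eq
      simp only [List.length_append, List.length_map, List.length_finRange, F, L] at this ⊢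
      omega
  · exact hc₂.trans (and_iff_right hpend)
  · rw [hp₂, hp₁]
    simp [Flags.start, or_and_right, exists_or]
  · rw [ha₂, ha₁]
    simp

theorem mem_restricted_iff {T : Instance} :
    T ∈ STACKELSATRestricted 0 ⊤ ↔
      (¬ ∃ a ∈ T.task.leaderActions ++ T.task.followerActions, a.HasPre) ∧ T.task.Sat := by
  simp [STACKELSATRestricted, STACKELSAT, Action.preCard_eq_zero_iff]

open Classical in
/-- Every pass but the last removes a subgoal, so the number of subgoals bounds the number of
further passes. -/
theorem run_machine (T : Instance) (k : ℕ) (R : Finset (Fin T.numFacts)) (hk : R.card ≤ k)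
    (hR : T.task.IsRegressed R) (M : List (Fin T.numFacts) → List Bool)
    (hM : (∀ l, M l = []) ∧ R = T.task.goal ∨ ∀ l, M l = bits l R) :
    Run ((k + 1) * (4 * T.encode.length + 3))
      (cfg .scan ⟨.start, none, none⟩ T.encode [] (M (List.finRange _)) [])
      (Turing.haltList machine [decide (T ∈ STACKELSATRestricted 0 ⊤)]) := by
  induction k using Nat.strong_induction_on generalizing R M with
  | _ k ih =>
    obtain ⟨f, h, hc, hp, ha⟩ := run_pass T R M hM
    cases hf : f.changed
    · have hfix := hc.1 hf
      rw [hf] at h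
      have h' := h.trans (run_clean T.encode.length f _ _ (by simp)
        (by simpa [bits] using T.numFacts_le))
      suffices hb : (f.acc && !f.pre) = decide (T ∈ STACKELSATRestricted 0 ⊤) by
        rw [hb] at h'
        exact h'.mono (by nlinarith)
      rw [Bool.eq_iff_iff, decide_eq_true_iff, mem_restricted_iff, Bool.and_eq_true,
        Bool.not_eq_true', ← Bool.not_eq_true, hp, and_comm]
      refine and_congr_right fun hpre => ?_
      rw [ha, hR.sat_iff (regress_eq_of_foldl_regress_eq hfix)]
      · exact fun a h₁ h₂ => hpre ⟨a, List.mem_append_left _ h₁, h₂⟩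
      · exact fun a h₁ h₂ => hpre ⟨a, List.mem_append_right _ h₁, h₂⟩
    · have hlt : (T.task.followerActions.foldl regress R).card < R.card := by
        refine Finset.card_lt_card ((foldl_regress_subset _ R).ssubset_of_ne fun he => ?_)
        simp [hc.2 he] at hf
      obtain ⟨k, rfl⟩ : ∃ j, k = j + 1 := ⟨k - 1, by omega⟩
      rw [hf] at h
      have h' := h.trans (run_rewind _ f _ _ _)
      rw [List.reverse_reverse, List.append_nil] at h'
      refine (h'.trans (ih k (Nat.lt_succ_self k) _ (by omega) hR.foldl (fun l => bits l _)
        (.inr fun _ => rfl))).mono ?_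
      rw [List.length_reverse]
      linarith

end Stackelberg

open Stackelberg in
theorem mainTheorem8 :
    Stackelberg.DecidableInPolyTime (Stackelberg.STACKELSATRestricted 0 ⊤) := by
  classical
  have h : ∀ T : Instance, Run
      (((Polynomial.X + 1) * (4 * Polynomial.X + 3) : Polynomial ℕ).eval T.encode.length)
      (Turing.initList machine T.encode)
      (Turing.haltList machine [decide (T ∈ STACKELSATRestricted 0 ⊤)]) := by
    intro T
    rw [initList_eq]
    refine (run_machine T T.encode.length T.task.goal ?_ T.task.isRegressed_goal (fun _ => [])
      (.inl ⟨fun _ => rfl, rfl⟩)).mono ?_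
    · exact (Finset.card_le_univ _).trans (by simpa using T.numFacts_le)
    · simp
  exact ⟨{
    tm := machine
    inputAlphabet := Equiv.refl Sym
    outputAlphabet := Equiv.refl Bool
    time := (Polynomial.X + 1) * (4 * Polynomial.X + 3)
    outputsFun := fun T => by
      have e : List.map (Equiv.refl Sym).invFun T.encode = T.encode := List.map_id _
      exact cast (congrArg (fun w => Turing.TM2OutputsInTime machine w
        (some [decide (T ∈ STACKELSATRestricted 0 ⊤)]) _) e.symm) (h T).some }⟩
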